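/- Let $K$ be a field and let $A=K[x_1,\dots,x_n]$ carry the degree reverse lexicographic (DRL) ordering with $x_1>\dots>x_n$. For an ideal $J\subset A$ let $\mathrm{in}(J)$ be the ideal generated by the leading terms of the elements of $J$, and let $E(J)$ be the set of minimal monomial generators of $\mathrm{in}(J)$. For $g\in \mathrm{GL}(K,n)$ put $g\cdot J=\{f(g\cdot X)\mid f\in J\}$, where $X=(x_1,\dots,x_n)$. For $f\in A$ let $f^h$ denote its homogeneous component of highest degree. Let $(f_1,\dots,f_s)$ be a regular sequence of non-zero affine polynomials of $A$, i.e. for every $i$ the polynomial $f_i^h$ is not a zero divisor in $A/\langle f_1^h,\dots,f_{i-1}^h\rangle$. Let $I=\langle f_1,\dots,f_s\rangle$ and $I^h=\langle f_1^h,\dots,f_s^h\rangle$. Then $$\mathrm{in}(I)=\mathrm{in}(I^h).$$ Assume moreover that $K$ is infinite. Then there is exactly one monomial ideal, the generic initial ideal $\mathrm{Gin}(I^h)$, that is equal to $\mathrm{in}(g\cdot I^h)$ for all $g$ in some non-empty Zariski open subset of $\mathrm{GL}(K,n)$; and there is a non-empty Zariski open set $U_a\subset\mathrm{GL}(K,n)$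 such that for all $g\in U_a$, $$E(g\cdot I)=E(\mathrm{Gin}(I^h)).$$ -/

import Mathlib

open MvPolynomial

/-! ### The degree reverse lexicographic ordering

Monomials of `K[x₁, …, xₙ]` are exponents `Fin n →₀ ℕ`, the variable `xᵢ` being `X (i - 1)`, and
`x₁ > ⋯ > xₙ`. -/

/-- The partial sum of the first `m` entries of an exponent. -/
def partialDegree {n : ℕ} (a : Fin n →₀ ℕ) (m : ℕ) : ℕ :=
  ∑ j ∈ Finset.univ.filter (fun j : Fin n => (j : ℕ) < m), a j

theorem partialDegree_full {n : ℕ} (a : Fin n →₀ ℕ) : partialDegree a n = a.degree := by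
  simp [partialDegree, Finsupp.degree_eq_sum]

theorem partialDegree_succ {n : ℕ} (a : Fin n →₀ ℕ) (i : Fin n) :
    partialDegree a (i + 1) = a i + partialDegree a i := by
  have : Finset.univ.filter (fun j : Fin n => (j : ℕ) < i + 1) =
      insert i (Finset.univ.filter (fun j : Fin n => (j : ℕ) < i)) := by
    ext j
    simp only [Finset.mem_filter, Finset.mem_univ, true_and, Finset.mem_insert, Fin.ext_iff]
    omega
  rw [partialDegree, this, Finset.sum_insert (by simp), partialDegree]

/-- The sequence `(a₁ + ⋯ + aₙ, a₁ + ⋯ + aₙ₋₁, …, a₁)` of partial sums of an exponent. Comparing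
these sequences lexicographically is the degree reverse lexicographic ordering, see
`drl_lt_iff`. -/
def drlKey (n : ℕ) : (Fin n →₀ ℕ) →+ (Fin n → ℕ) where
  toFun a i := partialDegree a (n - i)
  map_zero' := by
    funext i
    simp [partialDegree]
  map_add' a b := by
    funext i
    simp [partialDegree, Finset.sum_add_distrib]

theorem drlKey_apply {n : ℕ} (a : Fin n →₀ ℕ) (i : Fin n) :
    drlKey n a i = partialDegree a (n - i) := rfl

theorem drlKey_injective (n : ℕ) : Function.Injective (drlKey n) := by
  intro a b hab
  have key : ∀ m, m ≤ n → partialDegree a m = partialDegree b m := by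
    intro m hm
    rcases Nat.eq_zero_or_pos m with rfl | h
    · simp [partialDegree]
    · have := congrFun hab ⟨n - m, by omega⟩
      simp only [drlKey_apply] at this
      rwa [Nat.sub_sub_self hm] at this
  ext i
  have h1 := key (i + 1) (by omega)
  have h2 := key i (by omega)
  rw [partialDegree_succ, partialDegree_succ] at h1
  omega

/-- A type synonym of `Fin n →₀ ℕ` that carries the degree reverse lexicographic ordering. -/
def DegRevLex (n : ℕ) : Type := Fin n →₀ ℕ

noncomputable instance (n : ℕ) : AddCommMonoid (DegRevLex n) :=
  inferInstanceAs (AddCommMonoid (Fin n →₀ ℕ))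

noncomputable instance (n : ℕ) : LinearOrder (DegRevLex n) :=
  LinearOrder.lift' (fun a : DegRevLex n => toLex (drlKey n a))
    (fun _ _ h => drlKey_injective n (toLex.injective h))

theorem DegRevLex.lt_def {n : ℕ} {a b : DegRevLex n} :
    a < b ↔ toLex (drlKey n a) < toLex (drlKey n b) := Iff.rfl

theorem DegRevLex.le_def {n : ℕ} {a b : DegRevLex n} :
    a ≤ b ↔ toLex (drlKey n a) ≤ toLex (drlKey n b) := Iff.rfl

instance (n : ℕ) : IsOrderedAddMonoid (DegRevLex n) where
  add_le_add_left a b h c := by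
    rw [DegRevLex.le_def] at h ⊢
    have e : ∀ x y : DegRevLex n, drlKey n (x + y) = drlKey n x + drlKey n y :=
      fun x y => (drlKey n).map_add x y
    rw [e, e, toLex_add, toLex_add]
    exact add_le_add_left h _

instance (n : ℕ) : WellFoundedLT (DegRevLex n) :=
  ⟨InvImage.wf (fun a : DegRevLex n => toLex (drlKey n a))
    (wellFounded_lt (α := Lex (Fin n → ℕ)))⟩

/-- The degree reverse lexicographic ordering, as a monomial order. -/
noncomputable def drl (n : ℕ) : MonomialOrder (Fin n) where
  syn := DegRevLex n
  toSyn :=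
  { toEquiv := Equiv.refl (Fin n →₀ ℕ)
    map_add' := fun _ _ => rfl }
  toSyn_monotone a b h := by
    refine DegRevLex.le_def.2 (Pi.toLex_monotone fun i => ?_)
    change partialDegree a (n - i) ≤ partialDegree b (n - i)
    exact Finset.sum_le_sum fun j _ => h j

open scoped MonomialOrder in
/-- The usual description of the ordering: the degrees are compared first, and in case of a tie the
smaller monomial is the one with the larger exponent at the last place where they differ. -/
theorem drl_lt_iff {n : ℕ} {a b : Fin n →₀ ℕ} :
    a ≺[drl n] b ↔ a.degree < b.degree ∨
      (a.degree = b.degree ∧ ∃ i, (∀ j, i < j → a j = b j) ∧ b i < a i) := by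
  have h0 : a ≺[drl n] b ↔ ∃ k : Fin n, (∀ j : Fin n, j < k →
      partialDegree a (n - j) = partialDegree b (n - j)) ∧
      partialDegree a (n - k) < partialDegree b (n - k) := Iff.rfl
  rw [h0, ← partialDegree_full a, ← partialDegree_full b]
  constructor
  · rintro ⟨k, hk, hlt⟩
    rcases Nat.eq_zero_or_pos (k : ℕ) with h | h
    · left
      simpa [h] using hlt
    · right
      have hk' : ∀ m, n - k < m → m ≤ n → partialDegree a m = partialDegree b m := by
        intro m h1 h2
        have := hk ⟨n - m, by omega⟩ (by rw [Fin.lt_def]; simp only; omega)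
        simp only at this
        rwa [Nat.sub_sub_self h2] at this
      refine ⟨hk' n (by omega) le_rfl, ⟨n - k, by omega⟩, fun j hj => ?_, ?_⟩
      · rw [Fin.lt_def] at hj
        simp only at hj
        have h1 := hk' (j + 1) (by omega) (by omega)
        have h2 := hk' j (by omega) (by omega)
        rw [partialDegree_succ, partialDegree_succ] at h1
        omega
      · have h1 := hk' (n - k + 1) (by omega) (by omega)
        have h2 := partialDegree_succ a ⟨n - k, by omega⟩
        have h3 := partialDegree_succ b ⟨n - k, by omega⟩
        simp only at h2 h3
        omega
  · rintro (h | ⟨h, i, hi, hlt⟩)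
    · have hn : n ≠ 0 := by
        rintro rfl
        simp [partialDegree] at h
      exact ⟨⟨0, by omega⟩, fun j hj => absurd hj (by simp [Fin.lt_def]), by simpa using h⟩
    · have down : ∀ d, d + i + 1 ≤ n →
          partialDegree a (n - d) = partialDegree b (n - d) := by
        intro d
        induction d with
        | zero => exact fun _ => h
        | succ d ih =>
          intro hd
          have h1 := ih (by omega)
          have h2 := partialDegree_succ a ⟨n - (d + 1), by omega⟩
          have h3 := partialDegree_succ b ⟨n - (d + 1), by omega⟩
          have h4 := hi ⟨n - (d + 1), by omega⟩ (by rw [Fin.lt_def]; simp only; omega)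
          have e : n - (d + 1) + 1 = n - d := by omega
          simp only [e] at h2 h3
          omega
      have h1 := down (n - (i + 1)) (by omega)
      rw [Nat.sub_sub_self (by omega), partialDegree_succ, partialDegree_succ] at h1
      have hpos : (i : ℕ) ≠ 0 := by
        intro hz
        simp [hz, partialDegree] at h1
        omega
      refine ⟨⟨n - i, by omega⟩, fun j hj => ?_, ?_⟩
      · rw [Fin.lt_def] at hj
        simp only at hj
        exact down j (by omega)
      · simp only [Nat.sub_sub_self i.isLt.le]
        omega

section InitialIdeals

variable {K : Type*} [Field K] {n : ℕ}

/-! ### Initial ideals -/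

/-- The initial ideal `in(I)` for the degree reverse lexicographic ordering: the ideal generated by
the leading terms of the elements of `I`. -/
noncomputable def initialIdeal (I : Ideal (MvPolynomial (Fin n) K)) :
    Ideal (MvPolynomial (Fin n) K) :=
  Ideal.span ((fun f => (drl n).leadingTerm f) '' (I : Set (MvPolynomial (Fin n) K)))

/-- The minimal generators `E(I)` of the monomial ideal `in(I)`: the monomials of `in(I)` that are
minimal for divisibility. These are the leading terms of the reduced Gröbner basis of `I`. -/
def minimalInitialGenerators (I : Ideal (MvPolynomial (Fin n) K)) :
    Set (MvPolynomial (Fin n) K) :=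
  (fun a => monomial a (1 : K)) ''
    {a : Fin n →₀ ℕ | Minimal (fun b => monomial b (1 : K) ∈ initialIdeal I) a}

/-- An ideal generated by monomials. -/
def IsMonomialIdeal (J : Ideal (MvPolynomial (Fin n) K)) : Prop :=
  ∃ S : Set (Fin n →₀ ℕ), J = Ideal.span ((fun a => monomial a (1 : K)) '' S)

/-! ### Regular sequences of affine polynomials -/

/-- The homogeneous component of highest degree of a polynomial. -/
noncomputable def topComponent (f : MvPolynomial (Fin n) K) : MvPolynomial (Fin n) K :=
  homogeneousComponent f.totalDegree f

/-- A sequence of non-zero affine polynomials is regular if its components of highest degree form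
a regular sequence: each of them is not a zero divisor modulo the previous ones. -/
def IsAffineRegular {s : ℕ} (f : Fin s → MvPolynomial (Fin n) K) : Prop :=
  (∀ i, f i ≠ 0) ∧
    RingTheory.Sequence.IsWeaklyRegular (MvPolynomial (Fin n) K)
      (List.ofFn fun i => topComponent (f i))

/-! ### Linear changes of variables and generic initial ideals -/

/-- The substitution `f ↦ f(g · X)`, which maps `xᵢ` to `∑ⱼ gᵢⱼ xⱼ`. -/
noncomputable def linearSubst (g : GL (Fin n) K) :
    MvPolynomial (Fin n) K →ₐ[K] MvPolynomial (Fin n) K :=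
  aeval fun i => ∑ j, C (g.val i j) * X j

theorem linearSubst_mul (g h : GL (Fin n) K) (f : MvPolynomial (Fin n) K) :
    linearSubst (g * h) f = linearSubst h (linearSubst g f) := by
  have : linearSubst (g * h) = (linearSubst h).comp (linearSubst g) := by
    refine MvPolynomial.algHom_ext fun i => ?_
    simp only [linearSubst, aeval_X, AlgHom.comp_apply, map_sum, map_mul, aeval_C,
      Units.val_mul, Matrix.mul_apply, Finset.sum_mul, Finset.mul_sum, algebraMap_eq]
    rw [Finset.sum_comm]
    simp [mul_assoc]
  rw [this, AlgHom.comp_apply]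

theorem linearSubst_one (f : MvPolynomial (Fin n) K) : linearSubst 1 f = f := by
  have : linearSubst (1 : GL (Fin n) K) = AlgHom.id K _ := by
    refine MvPolynomial.algHom_ext fun i => ?_
    simp [linearSubst, Matrix.one_apply]
  rw [this, AlgHom.id_apply]

/-- The ideal `g · I = {f(g · X) | f ∈ I}`. -/
noncomputable def transformedIdeal (g : GL (Fin n) K) (I : Ideal (MvPolynomial (Fin n) K)) :
    Ideal (MvPolynomial (Fin n) K) :=
  I.map (linearSubst g)

theorem coe_transformedIdeal (g : GL (Fin n) K) (I : Ideal (MvPolynomial (Fin n) K)) :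
    (transformedIdeal g I : Set (MvPolynomial (Fin n) K)) = {p | ∃ f ∈ I, linearSubst g f = p} := by
  have hs : Function.Surjective (linearSubst g) := fun p =>
    ⟨linearSubst g⁻¹ p, by rw [← linearSubst_mul, inv_mul_cancel, linearSubst_one]⟩
  ext p
  exact Ideal.mem_map_iff_of_surjective (linearSubst g) hs

/-- Zariski open subsets of the group `GL(K, n)`: complements of the common zero loci of sets of
polynomials in the matrix entries. -/
def IsZariskiOpen (U : Set (GL (Fin n) K)) : Prop :=
  ∃ S : Set (MvPolynomial (Fin n × Fin n) K),
    U = {g | ∃ p ∈ S, eval (fun ij => g.val ij.1 ij.2) p ≠ 0}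

/-- `J` is a monomial ideal which is the initial ideal of `g · I` for all `g` in some non-empty
Zariski open subset of `GL(K, n)`. -/
def IsGenericInitialIdeal (I J : Ideal (MvPolynomial (Fin n) K)) : Prop :=
  IsMonomialIdeal J ∧ ∃ U : Set (GL (Fin n) K), IsZariskiOpen U ∧ U.Nonempty ∧
    ∀ g ∈ U, initialIdeal (transformedIdeal g I) = J

open Classical in
/-- The generic initial ideal `Gin(I)`: the ideal `J` with `IsGenericInitialIdeal I J` (and, by
convention, zero if there is no such ideal). -/
noncomputable def genericInitialIdeal (I : Ideal (MvPolynomial (Fin n) K)) :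
    Ideal (MvPolynomial (Fin n) K) :=
  if h : ∃ J, IsGenericInitialIdeal I J then h.choose else ⊥

end InitialIdeals

/-! For `in(I) = in(Iʰ)` the point is that top components of elements of `I` lie in `Iʰ`. In `p = ∑
gᵢ fᵢ` the summands may have larger degree than `p`; their leading forms then give a syzygy of the
`fᵢʰ`. Regularity makes it a Koszul syzygy, which can be subtracted at the level of the `fᵢ`,
lowering the degree of the summands (`TopRegular.exists_lower_cofactors`). Iterating down to the
degree of `p` shows that its top component is a combination of the `fᵢʰ`
(`TopRegular.topComponent_mem`). The converse lift needs no regularity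
(`exists_mem_topComponent_eq`). Since DRL compares degrees first, `p` and its top component have the
same leading monomial.

For the generic initial ideal of a homogeneous ideal, membership of a monomial in `in(g · I)` is a
jump between two ranks of coefficient vectors
(`ContainsComponents.mem_initialExponents_iff_coeffRank`). Each rank is generically constant,
because attaining the maximal rank is a nonvanishing condition on a polynomial in the entries of `g`
(`exists_isGeneric_coeffRank_eq`). This settles one monomial at a time, and only finitely many
conditions can be intersected. By Dickson's lemma finitely many minimal monomials give one
inclusion. Equality follows because the number of monomials of `in(g · I)` in each degree does not
depend on `g` (`coeffRank_transformedIdeal`).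

A linear substitution preserves regularity and commutes with top components, so the first statement
applied to `g · I` transfers the result from `Iʰ` to `I` on the same open set. -/

open scoped MonomialOrder

/-! ### Top components of combinations of an affine regular sequence -/

section AffineRegular

variable {K : Type*} [Field K] {n : ℕ}

/-- Every monomial of `g` has degree at most `D - d`, so that `g * f` has degree at most `D` when
`f` has degree `d`. -/
def HasCofactorBound (d D : ℕ) (g : MvPolynomial (Fin n) K) : Prop :=
  ∀ m, coeff m g ≠ 0 → m.degree + d ≤ D

theorem HasCofactorBound.zero (d D : ℕ) :
    HasCofactorBound d D (0 : MvPolynomial (Fin n) K) := fun m hm => absurd (coeff_zero m) hm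

theorem HasCofactorBound.add {d D : ℕ} {g h : MvPolynomial (Fin n) K}
    (hg : HasCofactorBound d D g) (hh : HasCofactorBound d D h) :
    HasCofactorBound d D (g + h) := by
  intro m hm
  by_contra hc
  have h1 : coeff m g = 0 := by_contra fun h => hc (hg m h)
  have h2 : coeff m h = 0 := by_contra fun h => hc (hh m h)
  exact hm (by simp [h1, h2])

theorem HasCofactorBound.neg {d D : ℕ} {g : MvPolynomial (Fin n) K}
    (hg : HasCofactorBound d D g) : HasCofactorBound d D (-g) := by
  intro m hm
  exact hg m (by simpa using hm)

theorem HasCofactorBound.sum {ι : Type*} {d D : ℕ} {g : ι → MvPolynomial (Fin n) K}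
    (s : Finset ι) (hg : ∀ i ∈ s, HasCofactorBound d D (g i)) :
    HasCofactorBound d D (∑ i ∈ s, g i) :=
  Finset.sum_induction g _ (fun _ _ => HasCofactorBound.add) (HasCofactorBound.zero d D) hg

theorem HasCofactorBound.mul {d e D : ℕ} {g h : MvPolynomial (Fin n) K}
    (hg : HasCofactorBound d D g) (hh : HasCofactorBound e d h) :
    HasCofactorBound e D (g * h) := by
  classical
  intro m hm
  obtain ⟨a, ha, b, hb, rfl⟩ := Finset.mem_add.1 (support_mul g h (mem_support_iff.2 hm))
  have h1 := hg a (mem_support_iff.1 ha)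
  have h2 := hh b (mem_support_iff.1 hb)
  rw [map_add]
  omega

/-- Additivity of degrees again, but with the allowance `d` for `h` reserved in the bound on `g`. It
serves the Koszul corrections, where a cofactor of one generator is multiplied by another generator.
-/
theorem HasCofactorBound.mul' {d e D : ℕ} {g h : MvPolynomial (Fin n) K}
    (hg : HasCofactorBound (e + d) D g) (hh : HasCofactorBound 0 d h) :
    HasCofactorBound e D (g * h) := by
  classical
  intro m hm
  obtain ⟨a, ha, b, hb, rfl⟩ := Finset.mem_add.1 (support_mul g h (mem_support_iff.2 hm))
  have h1 := hg a (mem_support_iff.1 ha)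
  have h2 := hh b (mem_support_iff.1 hb)
  rw [map_add]
  omega

theorem hasCofactorBound_totalDegree (f : MvPolynomial (Fin n) K) :
    HasCofactorBound 0 f.totalDegree f := by
  intro m hm
  simpa [Finsupp.degree_eq_sum, Finsupp.sum_fintype] using le_totalDegree (mem_support_iff.2 hm)

/-- The homogeneous component of degree `D - d`, or zero if `D < d`. -/
noncomputable def cofactorComponent (d D : ℕ) (g : MvPolynomial (Fin n) K) :
    MvPolynomial (Fin n) K :=
  if d ≤ D then homogeneousComponent (D - d) g else 0

/-- The additive condition covers both cases because of the guard `d ≤ D`: without it, truncated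
subtraction would select the constant term when `D < d`. -/
theorem coeff_cofactorComponent (d D : ℕ) (g : MvPolynomial (Fin n) K) (m : Fin n →₀ ℕ) :
    coeff m (cofactorComponent d D g) = if m.degree + d = D then coeff m g else 0 := by
  unfold cofactorComponent
  split_ifs with h1 h2 h2
  · rw [coeff_homogeneousComponent, if_pos (by omega)]
  · rw [coeff_homogeneousComponent, if_neg (by omega)]
  · omega
  · rfl

theorem hasCofactorBound_cofactorComponent (d D : ℕ) (g : MvPolynomial (Fin n) K) :
    HasCofactorBound d D (cofactorComponent d D g) := by
  intro m hm
  rw [coeff_cofactorComponent] at hm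
  split_ifs at hm with h
  · omega
  · exact absurd rfl hm

theorem cofactorComponent_cofactorComponent (d D : ℕ) (g : MvPolynomial (Fin n) K) :
    cofactorComponent d D (cofactorComponent d D g) = cofactorComponent d D g := by
  ext m
  simp only [coeff_cofactorComponent]
  split_ifs <;> rfl

theorem HasCofactorBound.of_cofactorComponent_eq_zero {d D : ℕ} {g : MvPolynomial (Fin n) K}
    (hg : HasCofactorBound d (D + 1) g) (h0 : cofactorComponent d (D + 1) g = 0) :
    HasCofactorBound d D g := by
  intro m hm
  have h1 := hg m hm
  have h2 := coeff_cofactorComponent d (D + 1) g m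
  rw [h0, coeff_zero] at h2
  split_ifs at h2 with h
  · exact absurd h2.symm hm
  · omega

theorem homogeneousComponent_mul_of_isHomogeneous {d : ℕ} (D : ℕ) (g : MvPolynomial (Fin n) K)
    {t : MvPolynomial (Fin n) K} (ht : t.IsHomogeneous d) :
    homogeneousComponent D (g * t) = cofactorComponent d D g * t := by
  classical
  ext m
  rw [coeff_homogeneousComponent, coeff_mul, coeff_mul, ← mul_boole, Finset.sum_mul]
  refine Finset.sum_congr rfl fun x hx => ?_
  rw [coeff_cofactorComponent]
  by_cases hx2 : coeff x.2 t = 0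
  · simp [hx2]
  · have h1 : x.2.degree = d := by
      by_contra h
      exact hx2 (ht.coeff_eq_zero h)
    rw [← Finset.HasAntidiagonal.mem_antidiagonal.1 hx, map_add, h1]
    split_ifs <;> simp

theorem topComponent_isHomogeneous (f : MvPolynomial (Fin n) K) :
    (topComponent f).IsHomogeneous f.totalDegree :=
  homogeneousComponent_isHomogeneous _ _

/-- The component of degree `D` of a product `g * f` of degree at most `D`. -/
theorem homogeneousComponent_mul_eq {D : ℕ} {f g : MvPolynomial (Fin n) K}
    (hg : HasCofactorBound f.totalDegree D g) :
    homogeneousComponent D (g * f) = cofactorComponent f.totalDegree D g * topComponent f := by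
  classical
  rw [← homogeneousComponent_mul_of_isHomogeneous D g (topComponent_isHomogeneous f), ← sub_eq_zero,
    ← map_sub, ← mul_sub]
  ext m
  rw [coeff_homogeneousComponent, coeff_zero]
  split_ifs with hm
  · by_contra h
    obtain ⟨a, ha, b, hb, rfl⟩ := Finset.mem_add.1 (support_mul _ _ (mem_support_iff.2 h))
    -- The bounds on `a` and `b` add up to at most `D`, so total degree `D` forces `b` to have the
    -- degree of `f`, where `f` and its top component agree.
    have h1 := hg a (mem_support_iff.1 ha)
    rw [mem_support_iff, coeff_sub, topComponent, coeff_homogeneousComponent] at hb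
    have h2 : coeff b f ≠ 0 := by
      intro h
      simp [h] at hb
    have h3 := hasCofactorBound_totalDegree f b h2
    rw [map_add] at hm
    rw [if_pos (by omega), sub_self] at hb
    exact hb rfl
  · rfl

/-- A homogeneous element of an ideal generated by homogeneous polynomials is a combination
with homogeneous coefficients. -/
theorem exists_homogeneous_cofactors {ι : Type*} [Fintype ι] {t : ι → MvPolynomial (Fin n) K}
    {d : ι → ℕ} (ht : ∀ i, (t i).IsHomogeneous (d i)) {p : MvPolynomial (Fin n) K}
    (hp : p ∈ Ideal.span (Set.range t)) (D : ℕ) :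
    ∃ h : ι → MvPolynomial (Fin n) K,
      homogeneousComponent D p = ∑ i, cofactorComponent (d i) D (h i) * t i := by
  obtain ⟨h, rfl⟩ := (Ideal.mem_span_range_iff_exists_fun).1 hp
  exact ⟨h, by simp_rw [map_sum, homogeneousComponent_mul_of_isHomogeneous D _ (ht _)]⟩

theorem homogeneousComponent_mem_span_range {ι : Type*} [Fintype ι]
    {t : ι → MvPolynomial (Fin n) K}
    {d : ι → ℕ} (ht : ∀ i, (t i).IsHomogeneous (d i)) {p : MvPolynomial (Fin n) K}
    (hp : p ∈ Ideal.span (Set.range t)) (D : ℕ) :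
    homogeneousComponent D p ∈ Ideal.span (Set.range t) := by
  obtain ⟨h, hh⟩ := exists_homogeneous_cofactors ht hp D
  exact hh ▸ Ideal.sum_mem _ fun i _ => Ideal.mul_mem_left _ _ (Ideal.subset_span ⟨i, rfl⟩)

/-- The components of highest degree form a regular sequence. -/
def TopRegular {s : ℕ} (f : Fin s → MvPolynomial (Fin n) K) : Prop :=
  ∀ i u, u * topComponent (f i) ∈ Ideal.span ((fun j => topComponent (f j)) '' Set.Iio i) →
    u ∈ Ideal.span ((fun j => topComponent (f j)) '' Set.Iio i)

theorem TopRegular.castSucc {s : ℕ} {f : Fin (s + 1) → MvPolynomial (Fin n) K}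
    (hf : TopRegular f) : TopRegular fun i : Fin s => f i.castSucc := by
  intro i u hu
  have e : (fun j : Fin s => topComponent (f j.castSucc)) '' Set.Iio i =
      (fun j => topComponent (f j)) '' Set.Iio i.castSucc := by
    ext x
    constructor
    · rintro ⟨j, hj, rfl⟩
      exact ⟨j.castSucc, Fin.castSucc_lt_castSucc_iff.2 hj, rfl⟩
    · rintro ⟨j, hj, rfl⟩
      have hj' : (j : ℕ) < i := hj
      exact ⟨⟨j, by omega⟩, hj', rfl⟩
  rw [e] at hu ⊢
  exact hf _ u hu

theorem TopRegular.last {s : ℕ} {f : Fin (s + 1) → MvPolynomial (Fin n) K}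
    (hf : TopRegular f) {u : MvPolynomial (Fin n) K}
    (hu : u * topComponent (f (Fin.last s)) ∈
      Ideal.span (Set.range fun j : Fin s => topComponent (f j.castSucc))) :
    u ∈ Ideal.span (Set.range fun j : Fin s => topComponent (f j.castSucc)) := by
  have e : (Set.range fun j : Fin s => topComponent (f j.castSucc)) =
      (fun j => topComponent (f j)) '' Set.Iio (Fin.last s) := by
    ext x
    constructor
    · rintro ⟨j, rfl⟩
      exact ⟨j.castSucc, Fin.castSucc_lt_last j, rfl⟩
    · rintro ⟨j, hj, rfl⟩
      have hj' : (j : ℕ) < s := hj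
      exact ⟨⟨j, hj'⟩, rfl⟩
  rw [e] at hu ⊢
  exact hf _ u hu

/-- If the leading forms of the summands cancel, the degree of the summands can be lowered. -/
theorem TopRegular.exists_lower_cofactors {s : ℕ} {f : Fin s → MvPolynomial (Fin n) K}
    (hf : TopRegular f) {D : ℕ} {g : Fin s → MvPolynomial (Fin n) K}
    (hg : ∀ i, HasCofactorBound (f i).totalDegree (D + 1) (g i))
    (h0 : homogeneousComponent (D + 1) (∑ i, g i * f i) = 0) :
    ∃ g' : Fin s → MvPolynomial (Fin n) K,
      (∀ i, HasCofactorBound (f i).totalDegree D (g' i)) ∧ ∑ i, g i * f i = ∑ i, g' i * f i := by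
  induction s with
  | zero => exact ⟨g, fun i => i.elim0, rfl⟩
  | succ s ih =>
    set dl := (f (Fin.last s)).totalDegree with hdl
    set u := cofactorComponent dl (D + 1) (g (Fin.last s)) with hu
    -- Vanishing in degree `D + 1` expresses `u` times the last top component by the earlier ones,
    -- so regularity applies to `u`.
    have hmem : u ∈ Ideal.span (Set.range fun j : Fin s => topComponent (f j.castSucc)) := by
      apply hf.last
      rw [Fin.sum_univ_castSucc, map_add, homogeneousComponent_mul_eq (hg _), map_sum] at h0
      rw [eq_neg_of_add_eq_zero_right h0]
      refine neg_mem (Ideal.sum_mem _ fun j _ => ?_)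
      rw [homogeneousComponent_mul_eq (hg _)]
      exact Ideal.mul_mem_left _ _ (Ideal.subset_span ⟨j, rfl⟩)
    by_cases hd : dl ≤ D + 1
    · obtain ⟨h, hh⟩ := exists_homogeneous_cofactors
        (fun j : Fin s => topComponent_isHomogeneous (f j.castSucc)) hmem (D + 1 - dl)
      set k : Fin s → MvPolynomial (Fin n) K := fun j =>
        cofactorComponent (f j.castSucc).totalDegree (D + 1 - dl) (h j) with hk
      have hkb : ∀ j, HasCofactorBound (f j.castSucc).totalDegree (D + 1 - dl) (k j) := fun j =>
        hasCofactorBound_cofactorComponent _ _ _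
      have hu' : homogeneousComponent (D + 1 - dl) u = u := by
        have := cofactorComponent_cofactorComponent dl (D + 1) (g (Fin.last s))
        rw [← hu] at this
        rwa [cofactorComponent, if_pos hd] at this
      rw [hu'] at hh
      -- `q` lifts `u` to the ideal of the earlier polynomials. Subtracting `q` from the last
      -- cofactor removes its leading form `u`, and `k j * f (Fin.last s)` added to the earlier
      -- cofactors compensates.
      set q := ∑ j, k j * f j.castSucc with hq
      have hcq : homogeneousComponent (D + 1 - dl) q = u := by
        rw [hh, hq, map_sum]
        refine Finset.sum_congr rfl fun j _ => ?_
        rw [homogeneousComponent_mul_eq (hkb j), hk, cofactorComponent_cofactorComponent]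
      have hqb : HasCofactorBound dl (D + 1) q := by
        have h1 : HasCofactorBound 0 (D + 1 - dl) q :=
          HasCofactorBound.sum _ fun j _ => (hkb j).mul (hasCofactorBound_totalDegree _)
        intro m hm
        have := h1 m hm
        omega
      have hlast : HasCofactorBound dl D (g (Fin.last s) + -q) := by
        refine HasCofactorBound.of_cofactorComponent_eq_zero ((hg _).add hqb.neg) ?_
        rw [cofactorComponent, if_pos hd, map_add, map_neg, hcq, hu, cofactorComponent, if_pos hd,
          add_neg_cancel]
      set g₁ : Fin s → MvPolynomial (Fin n) K := fun j =>
        g j.castSucc + k j * f (Fin.last s) with hg₁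
      have hg₁b : ∀ j, HasCofactorBound (f j.castSucc).totalDegree (D + 1) (g₁ j) := by
        refine fun j => (hg _).add (HasCofactorBound.mul' (d := dl) ?_
          (hasCofactorBound_totalDegree _))
        intro m hm
        have := hkb j m hm
        omega
      have key : ∑ i, g i * f i =
          ∑ j, g₁ j * f j.castSucc + (g (Fin.last s) + -q) * f (Fin.last s) := by
        have : ∑ j, g₁ j * f j.castSucc =
            ∑ j : Fin s, g j.castSucc * f j.castSucc + q * f (Fin.last s) := by
          rw [hq, Finset.sum_mul, ← Finset.sum_add_distrib]
          exact Finset.sum_congr rfl fun j _ => by rw [hg₁]; ring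
        rw [this, Fin.sum_univ_castSucc]
        ring
      -- The last summand now has degree at most `D`, so the shorter sum inherits the cancellation
      -- and the induction on `s` applies.
      have hz : homogeneousComponent (D + 1) (∑ j, g₁ j * f j.castSucc) = 0 := by
        have h1 : homogeneousComponent (D + 1) ((g (Fin.last s) + -q) * f (Fin.last s)) = 0 := by
          have h2 := hlast.mul (hasCofactorBound_totalDegree (f (Fin.last s)))
          ext m
          rw [coeff_homogeneousComponent, coeff_zero]
          split_ifs with hm
          · by_contra h
            have := h2 m h
            omega
          · rfl
        rw [key, map_add, h1, add_zero] at h0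
        exact h0
      obtain ⟨g', hg', he⟩ := ih hf.castSucc hg₁b hz
      refine ⟨Fin.snoc g' (g (Fin.last s) + -q), fun i => ?_, ?_⟩
      · refine Fin.lastCases ?_ (fun j => ?_) i
        · simpa using hlast
        · simpa using hg' j
      · rw [key, he, Fin.sum_univ_castSucc]
        simp
    -- Here the last polynomial has degree above `D + 1`, so the bound leaves no room for a nonzero
    -- cofactor.
    · have hgl : g (Fin.last s) = 0 := by
        ext m
        by_contra h
        have := hg _ m h
        omega
      have key : ∑ i, g i * f i = ∑ j : Fin s, g j.castSucc * f j.castSucc := by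
        rw [Fin.sum_univ_castSucc, hgl]
        simp
      obtain ⟨g', hg', he⟩ := ih hf.castSucc (fun j => hg j.castSucc) (key ▸ h0)
      refine ⟨Fin.snoc g' 0, fun i => ?_, ?_⟩
      · refine Fin.lastCases ?_ (fun j => ?_) i
        · simpa using HasCofactorBound.zero _ _
        · simpa using hg' j
      · rw [key, he, Fin.sum_univ_castSucc]
        simp

theorem totalDegree_eq_sup_degree (f : MvPolynomial (Fin n) K) :
    f.totalDegree = f.support.sup Finsupp.degree := by
  rw [totalDegree]
  exact Finset.sup_congr rfl fun m _ => by
    rw [Finsupp.degree_eq_sum, Finsupp.sum_fintype _ _ (by simp)]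

theorem topComponent_ne_zero {f : MvPolynomial (Fin n) K} (hf : f ≠ 0) : topComponent f ≠ 0 := by
  obtain ⟨m, hm, hmd⟩ :=
    (Finset.exists_mem_eq_sup f.support (support_nonempty.2 hf) Finsupp.degree)
  intro h
  have := congrArg (coeff m) h
  rw [topComponent, coeff_homogeneousComponent,
    if_pos (hmd.symm.trans (totalDegree_eq_sup_degree f).symm)] at this
  exact mem_support_iff.1 hm this

/-- Induction on the excess `e` of the cofactor bound over the degree of the sum. With no excess the
top component is read off termwise; otherwise the component in degree `D` cancels and the bound can
be lowered. -/
theorem TopRegular.topComponent_mem_of_le {s : ℕ} {f : Fin s → MvPolynomial (Fin n) K}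
    (hf : TopRegular f) {D e : ℕ} {g : Fin s → MvPolynomial (Fin n) K}
    (hg : ∀ i, HasCofactorBound (f i).totalDegree D (g i))
    (he : (∑ i, g i * f i).totalDegree + e = D) :
    topComponent (∑ i, g i * f i) ∈ Ideal.span (Set.range fun i => topComponent (f i)) := by
  induction e generalizing D g with
  | zero =>
    rw [topComponent, show (∑ i, g i * f i).totalDegree = D from he, map_sum]
    refine Ideal.sum_mem _ fun i _ => ?_
    rw [homogeneousComponent_mul_eq (hg i)]
    exact Ideal.mul_mem_left _ _ (Ideal.subset_span ⟨i, rfl⟩)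
  | succ e ih =>
    subst he
    obtain ⟨g', hg', h⟩ := hf.exists_lower_cofactors (D := (∑ i, g i * f i).totalDegree + e) hg
      (homogeneousComponent_eq_zero _ _ (by omega))
    rw [h]
    exact ih hg' (by rw [h])

theorem TopRegular.topComponent_mem {s : ℕ} {f : Fin s → MvPolynomial (Fin n) K}
    (hf : TopRegular f) {p : MvPolynomial (Fin n) K} (hp : p ∈ Ideal.span (Set.range f)) :
    topComponent p ∈ Ideal.span (Set.range fun i => topComponent (f i)) := by
  obtain ⟨g, rfl⟩ := (Ideal.mem_span_range_iff_exists_fun).1 hp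
  -- Any sufficiently large bound works; including the degree of the sum makes the excess explicit.
  refine hf.topComponent_mem_of_le (g := g)
    (D := (∑ i, g i * f i).totalDegree + ∑ i, ((g i).totalDegree + (f i).totalDegree))
    (fun i m hm => ?_) rfl
  have h1 := hasCofactorBound_totalDegree (g i) m hm
  have h2 := Finset.single_le_sum
    (f := fun i => (g i).totalDegree + (f i).totalDegree) (fun _ _ => Nat.zero_le _)
    (Finset.mem_univ i)
  omega

/-- Write the top component of `q` with homogeneous cofactors and replace each `topComponent (f i)`
by `f i`. Only terms of lower degree are added. -/
theorem exists_mem_topComponent_eq {s : ℕ} (f : Fin s → MvPolynomial (Fin n) K)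
    {q : MvPolynomial (Fin n) K} (hq : q ∈ Ideal.span (Set.range fun i => topComponent (f i))) :
    ∃ p ∈ Ideal.span (Set.range f), topComponent p = topComponent q := by
  rcases eq_or_ne q 0 with rfl | hq0
  · exact ⟨0, zero_mem _, rfl⟩
  obtain ⟨h, hh⟩ := exists_homogeneous_cofactors
    (fun i => topComponent_isHomogeneous (f i)) hq q.totalDegree
  have hb := fun i => hasCofactorBound_cofactorComponent (f i).totalDegree q.totalDegree (h i)
  set p := ∑ i, cofactorComponent (f i).totalDegree q.totalDegree (h i) * f i with hp
  have hc : homogeneousComponent q.totalDegree p = topComponent q := by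
    rw [topComponent, hh, hp, map_sum]
    refine Finset.sum_congr rfl fun i _ => ?_
    rw [homogeneousComponent_mul_eq (hb i), cofactorComponent_cofactorComponent]
  have hle : HasCofactorBound 0 q.totalDegree p :=
    HasCofactorBound.sum _ fun i _ => (hb i).mul (hasCofactorBound_totalDegree _)
  have hdeg : p.totalDegree = q.totalDegree := by
    refine le_antisymm ?_ ?_
    · rw [totalDegree_eq_sup_degree p]
      exact Finset.sup_le fun m hm => hle m (mem_support_iff.1 hm)
    · by_contra hlt
      rw [homogeneousComponent_eq_zero _ _ (by omega)] at hc
      exact topComponent_ne_zero hq0 hc.symm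
  refine ⟨p, Ideal.sum_mem _ fun i _ => Ideal.mul_mem_left _ _ (Ideal.subset_span ⟨i, rfl⟩), ?_⟩
  rw [← hc, topComponent, hdeg]

theorem IsAffineRegular.topRegular {s : ℕ} {f : Fin s → MvPolynomial (Fin n) K}
    (hf : IsAffineRegular f) : TopRegular f := by
  intro i u hu
  have h := (RingTheory.Sequence.isWeaklyRegular_iff_Fin _ _).1 hf.2 ⟨i, by simp⟩
  have e : Ideal.ofList ((List.ofFn fun i => topComponent (f i)).take i) =
      Ideal.span ((fun j => topComponent (f j)) '' Set.Iio i) := by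
    rw [Ideal.ofList]
    congr 1
    ext x
    simp only [Set.mem_ofPred_eq, Set.mem_image, Set.mem_Iio, List.mem_take_iff_getElem,
      List.getElem_ofFn, List.length_ofFn]
    constructor
    · rintro ⟨j, hj, rfl⟩
      exact ⟨⟨j, by omega⟩, by rw [Fin.lt_def]; simp only; omega, rfl⟩
    · rintro ⟨j, hj, rfl⟩
      exact ⟨j, by rw [Fin.lt_def] at hj; omega, rfl⟩
  rw [isSMulRegular_quotient_iff_mem_of_smul_mem] at h
  have h' := h u
  -- Weak regularity is phrased for a module modulo `J • ⊤`; for the ring itself this is `J`.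
  have e' : (Ideal.ofList ((List.ofFn fun i => topComponent (f i)).take i) • ⊤ :
      Submodule (MvPolynomial (Fin n) K) (MvPolynomial (Fin n) K)) =
      Ideal.span ((fun j => topComponent (f j)) '' Set.Iio i) := by
    rw [e]
    exact Ideal.mul_top _
  rw [e'] at h'
  refine h' ?_
  rw [mul_comm] at hu
  simpa using hu

end AffineRegular

/-! ### Initial ideals, their exponents and homogeneous components -/

section InitialIdealLemmas

variable {K : Type*} [Field K] {n : ℕ}

/-- The exponents of the monomials that belong to `in(I)`. -/
def initialExponents (I : Ideal (MvPolynomial (Fin n) K)) : Set (Fin n →₀ ℕ) :=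
  {a | monomial a (1 : K) ∈ initialIdeal I}

theorem initialExponents_upward {I : Ideal (MvPolynomial (Fin n) K)} {a b : Fin n →₀ ℕ}
    (ha : a ∈ initialExponents I) (hab : a ≤ b) : b ∈ initialExponents I := by
  have h : monomial b (1 : K) = monomial (b - a) 1 * monomial a 1 := by
    rw [monomial_mul, one_mul, tsub_add_cancel_of_le hab]
  change monomial b (1 : K) ∈ initialIdeal I
  rw [h]
  exact Ideal.mul_mem_left _ _ ha

theorem initialIdeal_eq_span_degree (I : Ideal (MvPolynomial (Fin n) K)) :
    initialIdeal I = Ideal.span ((fun a => monomial a (1 : K)) ''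
      {a | ∃ f ∈ I, f ≠ 0 ∧ (drl n).degree f = a}) := by
  apply le_antisymm
  · refine Ideal.span_le.2 ?_
    rintro _ ⟨f, hf, rfl⟩
    rcases eq_or_ne f 0 with rfl | h0
    · simp
    · have : (drl n).leadingTerm f =
          C ((drl n).leadingCoeff f) * monomial ((drl n).degree f) 1 := by
        rw [C_mul_monomial, mul_one]
        rfl
      simp only [this]
      exact Ideal.mul_mem_left _ _ (Ideal.subset_span ⟨_, ⟨f, hf, h0, rfl⟩, rfl⟩)
  · refine Ideal.span_le.2 ?_
    rintro _ ⟨_, ⟨f, hf, h0, rfl⟩, rfl⟩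
    have hc : (drl n).leadingCoeff f ≠ 0 := (drl n).leadingCoeff_ne_zero_iff.2 h0
    have : monomial ((drl n).degree f) (1 : K) =
        C ((drl n).leadingCoeff f)⁻¹ * (drl n).leadingTerm f := by
      rw [MonomialOrder.leadingTerm, C_mul_monomial, inv_mul_cancel₀ hc]
    simp only [this]
    exact Ideal.mul_mem_left _ _ (Ideal.subset_span ⟨f, hf, rfl⟩)

theorem monomial_mem_span_iff {S : Set (Fin n →₀ ℕ)} {a : Fin n →₀ ℕ} :
    monomial a (1 : K) ∈ Ideal.span ((fun a => monomial a (1 : K)) '' S) ↔ ∃ b ∈ S, b ≤ a := by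
  classical
  rw [mem_ideal_span_monomial_image]
  simp [support_monomial]

/-- Passing to the generated ideal adds no monomials: leading exponents are already closed upward,
since an element can be multiplied by a monomial. -/
theorem mem_initialExponents_iff {I : Ideal (MvPolynomial (Fin n) K)} {a : Fin n →₀ ℕ} :
    a ∈ initialExponents I ↔ ∃ f ∈ I, f ≠ 0 ∧ (drl n).degree f = a := by
  rw [initialExponents, Set.mem_ofPred_eq, initialIdeal_eq_span_degree, monomial_mem_span_iff]
  constructor
  · rintro ⟨_, ⟨f, hf, h0, rfl⟩, hb⟩
    have hm : monomial (a - (drl n).degree f) (1 : K) ≠ 0 := by simp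
    refine ⟨monomial (a - (drl n).degree f) 1 * f, Ideal.mul_mem_left _ _ hf, mul_ne_zero hm h0, ?_⟩
    classical
    rw [MonomialOrder.degree_mul hm h0, MonomialOrder.degree_monomial, if_neg one_ne_zero,
      tsub_add_cancel_of_le hb]
  · exact fun h => ⟨a, h, le_rfl⟩

theorem initialIdeal_eq_span_initialExponents (I : Ideal (MvPolynomial (Fin n) K)) :
    initialIdeal I = Ideal.span ((fun a => monomial a (1 : K)) '' initialExponents I) := by
  rw [initialIdeal_eq_span_degree]
  congr 2
  ext a
  exact mem_initialExponents_iff.symm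

/-- A monomial ideal contains every monomial of each of its elements, in particular the leading one.
Thus the minimal generators attached to `Gin` through its initial ideal are those of `Gin` itself.
-/
theorem IsMonomialIdeal.initialIdeal_eq {J : Ideal (MvPolynomial (Fin n) K)}
    (hJ : IsMonomialIdeal J) : initialIdeal J = J := by
  classical
  obtain ⟨S, rfl⟩ := hJ
  apply le_antisymm
  · rw [initialIdeal_eq_span_degree]
    refine Ideal.span_le.2 ?_
    rintro _ ⟨_, ⟨f, hf, h0, rfl⟩, rfl⟩
    exact monomial_mem_span_iff.2
      (mem_ideal_span_monomial_image.1 hf _ ((drl n).degree_mem_support h0))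
  · refine Ideal.span_le.2 ?_
    rintro _ ⟨a, ha, rfl⟩
    rw [initialIdeal_eq_span_degree]
    refine Ideal.subset_span ⟨a, ⟨monomial a 1, Ideal.subset_span ⟨a, ha, rfl⟩, by simp, ?_⟩, rfl⟩
    rw [MonomialOrder.degree_monomial, if_neg one_ne_zero]

theorem degree_drl_eq_of {f : MvPolynomial (Fin n) K} {a : Fin n →₀ ℕ} (ha : coeff a f ≠ 0)
    (h : ∀ b, a ≺[drl n] b → coeff b f = 0) : (drl n).degree f = a := by
  apply (drl n).toSyn.injective
  refine le_antisymm ?_ ((drl n).le_degree (mem_support_iff.2 ha))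
  by_contra hlt
  exact (drl n).coeff_degree_ne_zero_iff.2 (fun h0 => ha (by simp [h0])) (h _ (not_le.1 hlt))

/-- The leading monomial has maximal degree, so it survives in the top component. This is the only
point where the ordering must compare degrees first. -/
theorem degree_drl_topComponent (f : MvPolynomial (Fin n) K) :
    (drl n).degree (topComponent f) = (drl n).degree f := by
  rcases eq_or_ne f 0 with rfl | h0
  · simp [topComponent]
  have hd : ((drl n).degree f).degree = f.totalDegree := by
    refine le_antisymm (hasCofactorBound_totalDegree f _ ((drl n).coeff_degree_ne_zero_iff.2 h0)) ?_
    rw [totalDegree_eq_sup_degree]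
    refine Finset.sup_le fun m hm => ?_
    by_contra hlt
    exact not_lt.2 ((drl n).le_degree hm) (drl_lt_iff.2 (Or.inl (not_le.1 hlt)))
  refine degree_drl_eq_of ?_ fun b hb => ?_
  · rw [topComponent, coeff_homogeneousComponent, if_pos hd]
    exact (drl n).coeff_degree_ne_zero_iff.2 h0
  · rw [topComponent, coeff_homogeneousComponent, (drl n).coeff_eq_zero_of_lt hb, ite_self]

/-- `in(I) = in(Iʰ)` for a regular sequence. -/
theorem TopRegular.initialIdeal_eq {s : ℕ} {f : Fin s → MvPolynomial (Fin n) K}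
    (hf : TopRegular f) : initialIdeal (Ideal.span (Set.range f)) =
      initialIdeal (Ideal.span (Set.range fun i => topComponent (f i))) := by
  rw [initialIdeal_eq_span_degree, initialIdeal_eq_span_degree]
  congr 2
  ext a
  constructor
  · rintro ⟨p, hp, h0, rfl⟩
    exact ⟨topComponent p, hf.topComponent_mem hp, topComponent_ne_zero h0,
      degree_drl_topComponent p⟩
  · rintro ⟨q, hq, h0, rfl⟩
    obtain ⟨p, hp, he⟩ := exists_mem_topComponent_eq f hq
    refine ⟨p, hp, ?_, ?_⟩
    · rintro rfl
      exact topComponent_ne_zero h0 (he.symm.trans (by simp [topComponent]))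
    · rw [← degree_drl_topComponent, he, degree_drl_topComponent]

/-- An ideal that contains the homogeneous components of its elements. -/
def ContainsComponents (I : Ideal (MvPolynomial (Fin n) K)) : Prop :=
  ∀ p ∈ I, ∀ d, homogeneousComponent d p ∈ I

/-- A witness may be replaced by its component in the degree of `a`, so only the finitely many
monomials of that degree have to be tested. -/
theorem ContainsComponents.mem_initialExponents_iff {I : Ideal (MvPolynomial (Fin n) K)}
    (hI : ContainsComponents I) {a : Fin n →₀ ℕ} :
    a ∈ initialExponents I ↔ ∃ f ∈ I, coeff a f ≠ 0 ∧
      ∀ b : Fin n →₀ ℕ, b.degree = a.degree → a ≺[drl n] b → coeff b f = 0 := by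
  rw [_root_.mem_initialExponents_iff]
  constructor
  · rintro ⟨f, hf, h0, rfl⟩
    exact ⟨f, hf, (drl n).coeff_degree_ne_zero_iff.2 h0, fun b _ hb => (drl n).coeff_eq_zero_of_lt hb⟩
  · rintro ⟨f, hf, ha, hb⟩
    have hc : coeff a (homogeneousComponent a.degree f) ≠ 0 := by
      rwa [coeff_homogeneousComponent, if_pos rfl]
    refine ⟨_, hI f hf a.degree, fun h => hc (by rw [h, coeff_zero]), degree_drl_eq_of hc ?_⟩
    intro b hlt
    rw [coeff_homogeneousComponent]
    split_ifs with h
    · exact hb b h hlt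
    · rfl

/-! ### Linear substitutions -/

theorem linearSubst_inv_apply (g : GL (Fin n) K) (f : MvPolynomial (Fin n) K) :
    linearSubst g⁻¹ (linearSubst g f) = f := by
  rw [← linearSubst_mul, mul_inv_cancel, linearSubst_one]

theorem linearSubst_apply_inv (g : GL (Fin n) K) (f : MvPolynomial (Fin n) K) :
    linearSubst g (linearSubst g⁻¹ f) = f := by
  rw [← linearSubst_mul, inv_mul_cancel, linearSubst_one]

theorem linearSubst_isHomogeneous (g : GL (Fin n) K) {f : MvPolynomial (Fin n) K} {d : ℕ}
    (hf : f.IsHomogeneous d) : (linearSubst g f).IsHomogeneous d := by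
  have := hf.aeval (fun i => ∑ j, C (g.val i j) * X j) (n := 1)
    (fun i => IsHomogeneous.sum _ _ _ fun j _ => isHomogeneous_C_mul_X _ _)
  rwa [one_mul] at this

theorem homogeneousComponent_linearSubst (g : GL (Fin n) K) (d : ℕ) (f : MvPolynomial (Fin n) K) :
    homogeneousComponent d (linearSubst g f) = linearSubst g (homogeneousComponent d f) := by
  classical
  conv_lhs => rw [← sum_homogeneousComponent f]
  rw [map_sum, map_sum]
  simp_rw [fun i => homogeneousComponent_of_mem (m := d) (n := i)
    (linearSubst_isHomogeneous g (homogeneousComponent_isHomogeneous i f))]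
  rw [Finset.sum_ite_eq]
  split_ifs with h
  · rfl
  · rw [homogeneousComponent_eq_zero, map_zero]
    simpa using h

theorem totalDegree_linearSubst_le (g : GL (Fin n) K) (f : MvPolynomial (Fin n) K) :
    (linearSubst g f).totalDegree ≤ f.totalDegree := by
  by_contra h
  have h0 : linearSubst g f ≠ 0 := by
    intro h0
    simp [h0] at h
  apply topComponent_ne_zero h0
  rw [topComponent, homogeneousComponent_linearSubst, homogeneousComponent_eq_zero _ _ (not_le.1 h),
    map_zero]

theorem totalDegree_linearSubst (g : GL (Fin n) K) (f : MvPolynomial (Fin n) K) :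
    (linearSubst g f).totalDegree = f.totalDegree := by
  refine le_antisymm (totalDegree_linearSubst_le g f) ?_
  simpa [linearSubst_inv_apply] using totalDegree_linearSubst_le g⁻¹ (linearSubst g f)

theorem topComponent_linearSubst (g : GL (Fin n) K) (f : MvPolynomial (Fin n) K) :
    topComponent (linearSubst g f) = linearSubst g (topComponent f) := by
  rw [topComponent, totalDegree_linearSubst, homogeneousComponent_linearSubst, topComponent]

theorem ContainsComponents.transformedIdeal {I : Ideal (MvPolynomial (Fin n) K)}
    (hI : ContainsComponents I) (g : GL (Fin n) K) :
    ContainsComponents (transformedIdeal g I) := by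
  intro p hp d
  rw [← SetLike.mem_coe, coe_transformedIdeal] at hp ⊢
  obtain ⟨f, hf, rfl⟩ := hp
  exact ⟨_, hI f hf d, (homogeneousComponent_linearSubst g d f).symm⟩

theorem transformedIdeal_span (g : GL (Fin n) K) {ι : Type*} (f : ι → MvPolynomial (Fin n) K) :
    transformedIdeal g (Ideal.span (Set.range f)) =
      Ideal.span (Set.range fun i => linearSubst g (f i)) := by
  rw [transformedIdeal, Ideal.map_span, ← Set.range_comp]
  rfl

/-- Substitutions compose in reverse order, so this is a right action. -/
theorem transformedIdeal_mul (g h : GL (Fin n) K) (I : Ideal (MvPolynomial (Fin n) K)) :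
    transformedIdeal (g * h) I = transformedIdeal h (transformedIdeal g I) := by
  apply SetLike.coe_injective
  simp only [coe_transformedIdeal, linearSubst_mul]
  ext p
  constructor
  · rintro ⟨f, hf, rfl⟩
    refine ⟨linearSubst g f, ?_, rfl⟩
    exact Ideal.mem_map_of_mem _ hf
  · rintro ⟨q, hq, rfl⟩
    rw [← SetLike.mem_coe, coe_transformedIdeal] at hq
    obtain ⟨f, hf, rfl⟩ := hq
    exact ⟨f, hf, rfl⟩

theorem transformedIdeal_one (I : Ideal (MvPolynomial (Fin n) K)) :
    transformedIdeal 1 I = I := by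
  apply SetLike.coe_injective
  simp [coe_transformedIdeal, linearSubst_one]

/-- Substitution is an automorphism commuting with top components; pulling back by `g⁻¹` reduces to
the regularity of `f`. -/
theorem TopRegular.linearSubst {s : ℕ} {f : Fin s → MvPolynomial (Fin n) K}
    (hf : TopRegular f) (g : GL (Fin n) K) : TopRegular fun i => linearSubst g (f i) := by
  intro i u hu
  have e : Ideal.span ((fun j => topComponent (_root_.linearSubst g (f j))) '' Set.Iio i) =
      transformedIdeal g (Ideal.span ((fun j => topComponent (f j)) '' Set.Iio i)) := by
    rw [transformedIdeal, Ideal.map_span, Set.image_image]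
    simp_rw [topComponent_linearSubst]
  rw [e, topComponent_linearSubst, ← SetLike.mem_coe, coe_transformedIdeal] at hu
  rw [e]
  obtain ⟨p, hp, h⟩ := hu
  have h1 := congrArg (_root_.linearSubst g⁻¹) h
  rw [map_mul, linearSubst_inv_apply, linearSubst_inv_apply] at h1
  rw [h1] at hp
  have h2 := Ideal.mem_map_of_mem (_root_.linearSubst g) (hf i _ hp)
  rwa [linearSubst_apply_inv] at h2

end InitialIdealLemmas

/-! ### Coefficient ranks, genericity and Galligo's theorem -/

section GenericInitialIdeal

variable {K : Type*} [Field K] {n : ℕ}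

/-! ### Ranks of coefficient maps -/

/-- The coefficients at the monomials of `T`. -/
noncomputable def coeffsOn (K : Type*) [Field K] {n : ℕ} (T : Finset (Fin n →₀ ℕ)) :
    MvPolynomial (Fin n) K →ₗ[K] (T → K) :=
  LinearMap.pi fun t => lcoeff K t.1

@[simp] theorem coeffsOn_apply (T : Finset (Fin n →₀ ℕ)) (f : MvPolynomial (Fin n) K) (t : T) :
    coeffsOn K T f t = coeff t.1 f := rfl

/-- The rank of the coefficients at the monomials of `T` on a subspace. -/
noncomputable def coeffRank (T : Finset (Fin n →₀ ℕ)) (V : Submodule K (MvPolynomial (Fin n) K)) :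
    ℕ :=
  Module.finrank K (V.map (coeffsOn K T))

theorem coeffRank_le_card (T : Finset (Fin n →₀ ℕ))
    (V : Submodule K (MvPolynomial (Fin n) K)) : coeffRank T V ≤ T.card := by
  have := Submodule.finrank_le (V.map (coeffsOn K T))
  simpa [coeffRank] using this

theorem coeffRank_empty (V : Submodule K (MvPolynomial (Fin n) K)) : coeffRank ∅ V = 0 :=
  Nat.le_zero.1 (coeffRank_le_card ∅ V)

-- Rank-nullity for the projection `φ` forgetting the coordinate `a`: its kernel on the coefficient
-- vectors is at most a line, nonzero exactly when some `f` has a coefficient at `a` and none on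
-- `T`. If `a ∈ T`, both sides are trivially equal.
open Classical in
theorem coeffRank_insert (T : Finset (Fin n →₀ ℕ)) (a : Fin n →₀ ℕ)
    (V : Submodule K (MvPolynomial (Fin n) K)) :
    coeffRank (insert a T) V = coeffRank T V +
      if ∃ f ∈ V, coeff a f ≠ 0 ∧ ∀ b ∈ T, coeff b f = 0 then 1 else 0 := by
  let φ : (↥(insert a T) → K) →ₗ[K] (T → K) :=
    LinearMap.funLeft K K fun t => ⟨t.1, Finset.mem_insert_of_mem t.2⟩
  have hφ : φ ∘ₗ coeffsOn K (insert a T) = coeffsOn K T := rfl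
  set W := V.map (coeffsOn K (insert a T)) with hW
  have h1 := (φ.domRestrict W).finrank_range_add_finrank_ker
  rw [LinearMap.range_domRestrict, hW, ← Submodule.map_comp, hφ] at h1
  rw [coeffRank, coeffRank, ← h1]
  congr 1
  have hval : ∀ w : W, w ∈ LinearMap.ker (φ.domRestrict W) → ∀ t : ↥(insert a T), t.1 ≠ a →
      w.1 t = 0 := by
    intro w hw t ht
    exact congrFun (LinearMap.mem_ker.1 hw) ⟨t.1, Finset.mem_of_mem_insert_of_ne t.2 ht⟩
  split_ifs with h
  · obtain ⟨f, hf, hfa, hfT⟩ := h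
    have hker : (⟨coeffsOn K (insert a T) f, Submodule.mem_map_of_mem hf⟩ : W) ∈
        LinearMap.ker (φ.domRestrict W) :=
      LinearMap.mem_ker.2 (funext fun t => hfT t.1 t.2)
    refine finrank_eq_one (⟨_, hker⟩ : LinearMap.ker (φ.domRestrict W)) ?_ ?_
    · intro h0
      exact hfa (congrFun (congrArg (fun x => x.1.1) h0) ⟨a, Finset.mem_insert_self a T⟩)
    · rintro ⟨w, hw⟩
      refine ⟨w.1 ⟨a, Finset.mem_insert_self a T⟩ / coeff a f, ?_⟩
      refine Subtype.ext (Subtype.ext (funext fun t => ?_))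
      change _ * coeff t.1 f = w.1 t
      by_cases ht : t.1 = a
      · obtain ⟨t, ht'⟩ := t
        obtain rfl : t = a := ht
        exact div_mul_cancel₀ _ hfa
      · rw [hval w hw t ht, hfT _ (Finset.mem_of_mem_insert_of_ne t.2 ht), mul_zero]
  · have : LinearMap.ker (φ.domRestrict W) = ⊥ := by
      refine (Submodule.eq_bot_iff _).2 ?_
      rintro ⟨_, ⟨f, hf, rfl⟩⟩ hw
      have hT : ∀ b ∈ T, coeff b f = 0 := fun b hb => congrFun (LinearMap.mem_ker.1 hw) ⟨b, hb⟩
      refine Subtype.ext (funext fun t => ?_)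
      change coeff t.1 f = 0
      rcases Finset.mem_insert.1 t.2 with ht | ht
      · by_contra h0
        exact h ⟨f, hf, ht ▸ h0, hT⟩
      · exact hT _ ht
    rw [this, finrank_bot]

open Classical in
/-- The rank of the coefficients on `T` is the number of leading positions in `T`. -/
theorem coeffRank_eq_card (T : Finset (Fin n →₀ ℕ)) (V : Submodule K (MvPolynomial (Fin n) K)) :
    coeffRank T V = (T.filter fun a =>
      ∃ f ∈ V, coeff a f ≠ 0 ∧ ∀ b ∈ T, a ≺[drl n] b → coeff b f = 0).card := by
  -- Adding a new smallest exponent does not change which of the earlier ones are leading positions.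
  induction T using Finset.induction_on_min_value (drl n).toSyn with
  | empty => simpa using coeffRank_empty V
  | insert a s ha hmin ih =>
    have hlt : ∀ b ∈ s, a ≺[drl n] b := fun b hb =>
      lt_of_le_of_ne (hmin b hb) fun h => ha ((drl n).toSyn.injective h ▸ hb)
    rw [coeffRank_insert, ih, Finset.filter_insert]
    have e1 : (s.filter fun t => ∃ f ∈ V, coeff t f ≠ 0 ∧
        ∀ b ∈ insert a s, t ≺[drl n] b → coeff b f = 0) =
        s.filter fun t => ∃ f ∈ V, coeff t f ≠ 0 ∧ ∀ b ∈ s, t ≺[drl n] b → coeff b f = 0 := by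
      refine Finset.filter_congr fun t ht => ?_
      simp only [Finset.forall_mem_insert, (hmin t ht).not_gt, false_implies, true_and]
    have e2 : (∃ f ∈ V, coeff a f ≠ 0 ∧ ∀ b ∈ insert a s, a ≺[drl n] b → coeff b f = 0) ↔
        ∃ f ∈ V, coeff a f ≠ 0 ∧ ∀ b ∈ s, coeff b f = 0 := by
      simp only [Finset.forall_mem_insert, lt_irrefl, false_implies, true_and]
      refine exists_congr fun f => and_congr_right fun _ => and_congr_right fun _ => ?_
      exact forall₂_congr fun b hb => by simp [hlt b hb]
    rw [e1]
    by_cases h : ∃ f ∈ V, coeff a f ≠ 0 ∧ ∀ b ∈ s, coeff b f = 0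
    · rw [if_pos h, if_pos (e2.2 h), Finset.card_insert_of_notMem (by simp [ha])]
    · rw [if_neg h, if_neg (mt e2.1 h), add_zero]

/-- The exponents of degree `d`. -/
noncomputable def exponentsOfDegree (n d : ℕ) : Finset (Fin n →₀ ℕ) :=
  Finset.univ.finsuppAntidiag d

@[simp] theorem mem_exponentsOfDegree {d : ℕ} {a : Fin n →₀ ℕ} :
    a ∈ exponentsOfDegree n d ↔ a.degree = d := by
  simp [exponentsOfDegree, Finset.mem_finsuppAntidiag, Finsupp.degree_eq_sum]

open Classical in
theorem ContainsComponents.coeffRank_eq_card {I : Ideal (MvPolynomial (Fin n) K)}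
    (hI : ContainsComponents I) (d : ℕ) :
    coeffRank (exponentsOfDegree n d) (I.restrictScalars K) =
      ((exponentsOfDegree n d).filter (· ∈ initialExponents I)).card := by
  rw [_root_.coeffRank_eq_card]
  congr 1
  refine Finset.filter_congr fun a ha => ?_
  rw [hI.mem_initialExponents_iff]
  simp only [mem_exponentsOfDegree] at ha ⊢
  subst ha
  rfl

open Classical in
/-- Membership of a monomial in the initial ideal is detected by two ranks. -/
theorem ContainsComponents.mem_initialExponents_iff_coeffRank {I : Ideal (MvPolynomial (Fin n) K)}
    (hI : ContainsComponents I) (a : Fin n →₀ ℕ) {T : Finset (Fin n →₀ ℕ)}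
    (hT : ∀ b, b ∈ T ↔ b.degree = a.degree ∧ a ≺[drl n] b) :
    a ∈ initialExponents I ↔
      coeffRank (insert a T) (I.restrictScalars K) ≠ coeffRank T (I.restrictScalars K) := by
  have := coeffRank_insert T a (I.restrictScalars K)
  rw [hI.mem_initialExponents_iff]
  have e : (∃ f ∈ I, coeff a f ≠ 0 ∧
      ∀ b : Fin n →₀ ℕ, b.degree = a.degree → a ≺[drl n] b → coeff b f = 0) ↔
      ∃ f ∈ I.restrictScalars K, coeff a f ≠ 0 ∧ ∀ b ∈ T, coeff b f = 0 := by
    simp only [hT, and_imp, Submodule.restrictScalars_mem]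
  rw [e]
  rw [this]
  split_ifs with h
  · exact iff_of_true h (Nat.succ_ne_self _)
  · exact iff_of_false h (not_not.2 rfl)

/-- Substitution preserves degrees, so it induces a linear map `Φ` on coefficient vectors in degree
`d`, and a linear image cannot have larger dimension. -/
theorem coeffRank_transformedIdeal_le (d : ℕ) (g : GL (Fin n) K)
    (I : Ideal (MvPolynomial (Fin n) K)) :
    coeffRank (exponentsOfDegree n d) ((transformedIdeal g I).restrictScalars K) ≤
      coeffRank (exponentsOfDegree n d) (I.restrictScalars K) := by
  classical
  set T := exponentsOfDegree n d with hT
  let Φ : (T → K) →ₗ[K] (T → K) :=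
    coeffsOn K T ∘ₗ (linearSubst g).toLinearMap ∘ₗ
      ∑ t : T, (monomial t.1).comp (LinearMap.proj t)
  have hΦ : ∀ f, Φ (coeffsOn K T f) = coeffsOn K T (linearSubst g f) := by
    intro f
    have h1 : (∑ t : T, (monomial t.1).comp (LinearMap.proj t) :
        (T → K) →ₗ[K] MvPolynomial (Fin n) K) (coeffsOn K T f) = homogeneousComponent d f := by
      ext m
      rw [coeff_homogeneousComponent]
      rw [LinearMap.sum_apply, coeff_sum]
      simp only [LinearMap.comp_apply, LinearMap.proj_apply, coeffsOn_apply, coeff_monomial]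
      rw [Finset.sum_coe_sort T fun t => if t = m then coeff t f else 0, Finset.sum_ite_eq']
      simp [hT]
    change coeffsOn K T (linearSubst g (_ : MvPolynomial (Fin n) K)) = _
    rw [h1, ← homogeneousComponent_linearSubst]
    funext t
    have ht : t.1.degree = d := mem_exponentsOfDegree.1 t.2
    rw [coeffsOn_apply, coeffsOn_apply, coeff_homogeneousComponent, if_pos ht]
  have hmap : ((transformedIdeal g I).restrictScalars K).map (coeffsOn K T) =
      ((I.restrictScalars K).map (coeffsOn K T)).map Φ := by
    ext v
    simp only [Submodule.mem_map, Submodule.restrictScalars_mem]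
    constructor
    · rintro ⟨p, hp, rfl⟩
      rw [← SetLike.mem_coe, coe_transformedIdeal] at hp
      obtain ⟨f, hf, rfl⟩ := hp
      exact ⟨_, ⟨f, hf, rfl⟩, hΦ f⟩
    · rintro ⟨_, ⟨f, hf, rfl⟩, rfl⟩
      exact ⟨linearSubst g f, Ideal.mem_map_of_mem _ hf, (hΦ f).symm⟩
  rw [coeffRank, hmap]
  exact Submodule.finrank_map_le _ _

theorem coeffRank_transformedIdeal (d : ℕ) (g : GL (Fin n) K)
    (I : Ideal (MvPolynomial (Fin n) K)) :
    coeffRank (exponentsOfDegree n d) ((transformedIdeal g I).restrictScalars K) =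
      coeffRank (exponentsOfDegree n d) (I.restrictScalars K) := by
  refine le_antisymm (coeffRank_transformedIdeal_le d g I) ?_
  have := coeffRank_transformedIdeal_le d g⁻¹ (transformedIdeal g I)
  rwa [← transformedIdeal_mul, mul_inv_cancel, transformedIdeal_one] at this

/-! ### Generic properties of matrices -/

/-- A property of invertible matrices that holds outside of a hypersurface. -/
def IsGeneric (P : GL (Fin n) K → Prop) : Prop :=
  ∃ p : MvPolynomial (Fin n × Fin n) K, p ≠ 0 ∧
    ∀ g : GL (Fin n) K, eval (fun ij => g.val ij.1 ij.2) p ≠ 0 → P g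

theorem IsGeneric.mono {P Q : GL (Fin n) K → Prop} (hP : IsGeneric P) (h : ∀ g, P g → Q g) :
    IsGeneric Q := by
  obtain ⟨p, hp, hP⟩ := hP
  exact ⟨p, hp, fun g hg => h g (hP g hg)⟩

theorem IsGeneric.and {P Q : GL (Fin n) K → Prop} (hP : IsGeneric P) (hQ : IsGeneric Q) :
    IsGeneric fun g => P g ∧ Q g := by
  obtain ⟨p, hp, hP⟩ := hP
  obtain ⟨q, hq, hQ⟩ := hQ
  refine ⟨p * q, mul_ne_zero hp hq, fun g hg => ?_⟩
  rw [map_mul] at hg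
  exact ⟨hP g (left_ne_zero_of_mul hg), hQ g (right_ne_zero_of_mul hg)⟩

theorem IsGeneric.forall_mem_finset {ι : Type*} (s : Finset ι) {P : ι → GL (Fin n) K → Prop}
    (h : ∀ i ∈ s, IsGeneric (P i)) : IsGeneric fun g => ∀ i ∈ s, P i g := by
  classical
  induction s using Finset.induction_on with
  | empty => exact ⟨1, one_ne_zero, by simp⟩
  | insert a s _ ih =>
    refine ((h a (Finset.mem_insert_self a s)).and
      (ih fun i hi => h i (Finset.mem_insert_of_mem hi))).mono fun g hg => ?_
    exact (Finset.forall_mem_insert _ _ _).2 hg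

/-- Multiplying `p` by the generic determinant forces a point of nonvanishing to be an invertible
matrix. -/
theorem exists_eval_ne_zero [Infinite K] {p : MvPolynomial (Fin n × Fin n) K} (hp : p ≠ 0) :
    ∃ g : GL (Fin n) K, eval (fun ij => g.val ij.1 ij.2) p ≠ 0 := by
  classical
  set δ := (Matrix.mvPolynomialX (Fin n) (Fin n) K).det with hδ
  have hδ0 : δ ≠ 0 := Matrix.det_mvPolynomialX_ne_zero (Fin n) K
  have h : p * δ ≠ 0 := mul_ne_zero hp hδ0
  obtain ⟨x, hx⟩ : ∃ x, eval x (p * δ) ≠ 0 := by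
    by_contra hc
    push Not at hc
    exact h (MvPolynomial.funext fun x => by rw [hc, map_zero])
  rw [map_mul] at hx
  have hdet : eval x δ = (Matrix.of fun i j => x (i, j)).det := by
    rw [hδ, RingHom.map_det]
    congr 1
    ext i j
    simp [Matrix.mvPolynomialX]
  refine ⟨Matrix.GeneralLinearGroup.mkOfDetNeZero (Matrix.of fun i j => x (i, j))
    (hdet ▸ right_ne_zero_of_mul hx), ?_⟩
  exact left_ne_zero_of_mul hx

theorem IsGeneric.exists [Infinite K] {P : GL (Fin n) K → Prop} (hP : IsGeneric P) : ∃ g, P g := by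
  obtain ⟨p, hp, hP⟩ := hP
  obtain ⟨g, hg⟩ := exists_eval_ne_zero hp
  exact ⟨g, hP g hg⟩

theorem IsGeneric.exists_isZariskiOpen [Infinite K] {P : GL (Fin n) K → Prop} (hP : IsGeneric P) :
    ∃ U : Set (GL (Fin n) K), IsZariskiOpen U ∧ U.Nonempty ∧ ∀ g ∈ U, P g := by
  obtain ⟨p, hp, hP⟩ := hP
  obtain ⟨g, hg⟩ := exists_eval_ne_zero hp
  refine ⟨_, ⟨{p}, rfl⟩, ⟨g, p, rfl, hg⟩, ?_⟩
  rintro g ⟨q, rfl, hq⟩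
  exact hP g hq

theorem IsZariskiOpen.isGeneric {U : Set (GL (Fin n) K)} (hU : IsZariskiOpen U)
    (hne : U.Nonempty) : IsGeneric (· ∈ U) := by
  obtain ⟨S, rfl⟩ := hU
  obtain ⟨g, p, hp, hg⟩ := hne
  exact ⟨p, fun h => hg (by rw [h, map_zero]), fun g' hg' => ⟨p, hp, hg'⟩⟩

/-- The coefficients of `f(g · X)` are polynomials in the entries of `g`. -/
theorem exists_eval_eq_coeff_linearSubst (f : MvPolynomial (Fin n) K) (t : Fin n →₀ ℕ) :
    ∃ q : MvPolynomial (Fin n × Fin n) K, ∀ g : GL (Fin n) K,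
      eval (fun ij => g.val ij.1 ij.2) q = coeff t (linearSubst g f) := by
  -- `F` substitutes the generic matrix, whose entries are the variables `X (i, j)`.
  let F : MvPolynomial (Fin n) K →ₐ[K] MvPolynomial (Fin n) (MvPolynomial (Fin n × Fin n) K) :=
    aeval fun i => ∑ j, C (X (i, j)) * X j
  refine ⟨coeff t (F f), fun g => ?_⟩
  rw [← coeff_map]
  congr 1
  have : (mapAlgHom (aeval fun ij : Fin n × Fin n => g.val ij.1 ij.2)).comp F = linearSubst g := by
    refine MvPolynomial.algHom_ext fun i => ?_
    simp [F, linearSubst]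
  exact DFunLike.congr_fun this f

/-- `B` is the matrix of a left inverse of `c ↦ ∑ cᵢ vᵢ`. It lets a single determinant certify
independence of nearby rows, without choosing a minor. -/
theorem exists_mul_eq_one_of_linearIndependent {T : Type*} [Fintype T] {r : ℕ}
    {v : Fin r → T → K} (hv : LinearIndependent K v) :
    ∃ B : Matrix T (Fin r) K, Matrix.of v * B = 1 := by
  classical
  obtain ⟨L, hL⟩ := LinearMap.exists_leftInverse_of_injective (Fintype.linearCombination K v)
    (LinearMap.ker_eq_bot.2 (linearIndependent_iff_injective_fintypeLinearCombination.1 hv))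
  refine ⟨Matrix.of fun t j => L (fun k => if t = k then 1 else 0) j, ?_⟩
  ext i j
  have h1 := congrFun (DFunLike.congr_fun hL (Pi.single i 1)) j
  rw [LinearMap.comp_apply, LinearMap.id_apply, Fintype.linearCombination_apply_single, one_smul,
    LinearMap.pi_apply_eq_sum_univ, Finset.sum_apply] at h1
  rw [Matrix.one_apply, Matrix.mul_apply]
  simpa [Pi.single_apply, eq_comm] using h1

/-- The rank of the coefficients is generically constant. -/
theorem exists_isGeneric_coeffRank_eq (T : Finset (Fin n →₀ ℕ))
    (I : Ideal (MvPolynomial (Fin n) K)) :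
    ∃ r, IsGeneric fun g : GL (Fin n) K =>
      coeffRank T ((transformedIdeal g I).restrictScalars K) = r := by
  classical
  set ρ : GL (Fin n) K → ℕ := fun g =>
    coeffRank T ((transformedIdeal g I).restrictScalars K) with hρ
  -- The rank is bounded by the size of `T`, so its maximum is attained; the generic value is this
  -- maximum.
  obtain ⟨g₀, hg₀⟩ : ∃ g₀, ∀ g, ρ g ≤ ρ g₀ := by
    have hb : (Set.range ρ).Finite :=
      (Set.finite_Iic T.card).subset (by rintro _ ⟨g, rfl⟩; exact coeffRank_le_card _ _)
    obtain ⟨_, ⟨g₀, rfl⟩, h⟩ := Set.exists_max_image _ id hb ⟨_, 1, rfl⟩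
    exact ⟨g₀, fun g => h _ ⟨g, rfl⟩⟩
  obtain ⟨r, hr⟩ : ∃ r, ρ g₀ = r := ⟨_, rfl⟩
  rw [hr] at hg₀
  refine ⟨r, ?_⟩
  let b := Module.finBasisOfFinrankEq K
    (((transformedIdeal g₀ I).restrictScalars K).map (coeffsOn K T)) hr
  have hf : ∀ i, ∃ f ∈ I, coeffsOn K T (linearSubst g₀ f) = (b i : T → K) := by
    intro i
    obtain ⟨p, hp, h⟩ := (b i).2
    rw [SetLike.mem_coe, Submodule.restrictScalars_mem, ← SetLike.mem_coe,
      coe_transformedIdeal] at hp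
    obtain ⟨f, hf, rfl⟩ := hp
    exact ⟨f, hf, h⟩
  choose f hfI hfb using hf
  choose q hq using exists_eval_eq_coeff_linearSubst (K := K) (n := n)
  obtain ⟨B, hB⟩ := exists_mul_eq_one_of_linearIndependent
    (b.linearIndependent.map' (Submodule.subtype _) (Submodule.ker_subtype _))
  let M : Matrix (Fin r) T (MvPolynomial (Fin n × Fin n) K) :=
    Matrix.of fun i t => q (f i) t.1
  -- At `g₀` the product is the identity, so `p` takes the value `1` there. Where `p` does not
  -- vanish the rows stay independent, which gives rank at least `r`.
  let p : MvPolynomial (Fin n × Fin n) K := (M * B.map C).det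
  have hp : ∀ g : GL (Fin n) K, eval (fun ij => g.val ij.1 ij.2) p =
      ((Matrix.of fun i (t : T) => coeff t.1 (linearSubst g (f i))) * B).det := by
    intro g
    refine (RingHom.map_det (eval fun ij : Fin n × Fin n => g.val ij.1 ij.2) (M * B.map C)).trans ?_
    congr 1
    ext i j
    have h1 : (M * B.map C : Matrix (Fin r) (Fin r) (MvPolynomial (Fin n × Fin n) K)) i j =
        ∑ t : T, q (f i) t.1 * C (B t j) := Matrix.mul_apply
    refine (congrArg (eval fun ij : Fin n × Fin n => g.val ij.1 ij.2) h1).trans ?_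
    simp [Matrix.mul_apply, hq]
  refine ⟨p, ?_, fun g hg => le_antisymm (hg₀ g) ?_⟩
  · intro h0
    have h1 := hp g₀
    have h2 : (Matrix.of fun i (t : T) => coeff t.1 (linearSubst g₀ (f i))) =
        Matrix.of (Submodule.subtype _ ∘ b) := by
      ext i t
      exact congrFun (hfb i) t
    rw [h2, hB, h0, map_zero, Matrix.det_one] at h1
    exact zero_ne_one h1
  · rw [hp] at hg
    have hli : LinearIndependent K fun i => coeffsOn K T (linearSubst g (f i)) := by
      rw [Fintype.linearIndependent_iff]
      intro c hc
      have h1 : Matrix.vecMul c (Matrix.of fun i (t : T) => coeff t.1 (linearSubst g (f i))) = 0 := by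
        funext t
        have := congrFun hc t
        simpa [Matrix.vecMul, dotProduct] using this
      have h2 := congrArg (fun v => Matrix.vecMul v B) h1
      simp only [Matrix.vecMul_vecMul, Matrix.zero_vecMul] at h2
      exact congrFun (Matrix.eq_zero_of_vecMul_eq_zero hg h2)
    have hli' : LinearIndependent K fun i =>
        (⟨coeffsOn K T (linearSubst g (f i)), Submodule.mem_map_of_mem
          (Ideal.mem_map_of_mem (linearSubst g) (hfI i))⟩ :
          ((transformedIdeal g I).restrictScalars K).map (coeffsOn K T)) :=
      LinearIndependent.of_comp (Submodule.subtype _) hli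
    simpa [hρ, coeffRank] using hli'.fintype_card_le_finrank

/-- Membership of a monomial in the initial ideal of `g · I` is generically constant. -/
theorem ContainsComponents.exists_isGeneric_mem_iff {I : Ideal (MvPolynomial (Fin n) K)}
    (hI : ContainsComponents I) (a : Fin n →₀ ℕ) :
    ∃ P : Prop, IsGeneric fun g : GL (Fin n) K =>
      (a ∈ initialExponents (_root_.transformedIdeal g I) ↔ P) := by
  classical
  set T := (exponentsOfDegree n a.degree).filter (fun b => a ≺[drl n] b) with hT
  obtain ⟨r, hr⟩ := exists_isGeneric_coeffRank_eq T I
  obtain ⟨r', hr'⟩ := exists_isGeneric_coeffRank_eq (insert a T) I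
  refine ⟨r' ≠ r, (hr.and hr').mono ?_⟩
  rintro g ⟨h1, h2⟩
  rw [(hI.transformedIdeal g).mem_initialExponents_iff_coeffRank a (T := T) (by simp [hT]), h1, h2]

/-- Galligo's theorem: the initial ideal is constant in generic coordinates. -/
theorem ContainsComponents.exists_isGeneric_initialIdeal_eq [Infinite K]
    {I : Ideal (MvPolynomial (Fin n) K)} (hI : ContainsComponents I) :
    ∃ J : Ideal (MvPolynomial (Fin n) K), IsMonomialIdeal J ∧
      IsGeneric fun g : GL (Fin n) K => initialIdeal (_root_.transformedIdeal g I) = J := by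
  classical
  choose P hP using hI.exists_isGeneric_mem_iff
  set M : Set (Fin n →₀ ℕ) := {a | P a} with hM
  -- Dickson's lemma. Here `M` is just the set of generically present exponents, not yet known to be
  -- closed upward.
  have hfin : {a | Minimal (· ∈ M) a}.Finite :=
    WellQuasiOrderedLE.finite_of_isAntichain (setOfPred_minimal_antichain (· ∈ M))
  refine ⟨Ideal.span ((fun a => monomial a (1 : K)) '' M), ⟨M, rfl⟩,
    (IsGeneric.forall_mem_finset hfin.toFinset fun a _ => hP a).mono fun g hg => ?_⟩
  have hsub : ∀ a, P a → a ∈ initialExponents (_root_.transformedIdeal g I) := by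
    intro a ha
    obtain ⟨b, hba, hb⟩ := exists_minimal_le_of_wellFoundedLT (· ∈ M) a ha
    exact initialExponents_upward ((hg b (hfin.mem_toFinset.2 hb)).2 hb.prop) hba
  rw [initialIdeal_eq_span_initialExponents]
  congr 2
  ext a
  refine ⟨fun ha => ?_, hsub a⟩
  -- An auxiliary `g'`, depending on the degree of `a`, realises all generic values in that degree.
  -- Equal counts for `g` and `g'` turn the inclusion `hsub` into an equality there.
  obtain ⟨g', hg'⟩ := (IsGeneric.forall_mem_finset (exponentsOfDegree n a.degree)
    fun a _ => hP a).exists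
  have hcard := (hI.transformedIdeal g).coeffRank_eq_card a.degree
  rw [coeffRank_transformedIdeal, ← coeffRank_transformedIdeal a.degree g',
    (hI.transformedIdeal g').coeffRank_eq_card, Finset.filter_congr hg'] at hcard
  have heq := Finset.eq_of_subset_of_card_le
    (Finset.monotone_filter_right (exponentsOfDegree n a.degree) fun a _ => hsub a) hcard.ge
  have hmem : a ∈ (exponentsOfDegree n a.degree).filter P :=
    heq ▸ Finset.mem_filter.2 ⟨mem_exponentsOfDegree.2 rfl, ha⟩
  exact (Finset.mem_filter.1 hmem).2

/-- Uniqueness holds because two non-empty open sets meet: the product of their nonzero polynomials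
is nonzero, and `K` is infinite. -/
theorem ContainsComponents.existsUnique_isGenericInitialIdeal [Infinite K]
    {I : Ideal (MvPolynomial (Fin n) K)} (hI : ContainsComponents I) :
    ∃! J, IsGenericInitialIdeal I J := by
  obtain ⟨J, hJ, hgen⟩ := hI.exists_isGeneric_initialIdeal_eq
  refine ⟨J, ⟨hJ, hgen.exists_isZariskiOpen⟩, ?_⟩
  rintro J' ⟨-, U, hU, hne, hJ'⟩
  obtain ⟨g, h1, h2⟩ := (hgen.and (hU.isGeneric hne)).exists
  rw [← hJ' g h2, h1]

end GenericInitialIdeal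

/-! ### Affine regular sequences in generic coordinates -/

theorem mainTheorem5 {K : Type*} [Field K] {n s : ℕ} (f : Fin s → MvPolynomial (Fin n) K)
    (hf : IsAffineRegular f)
    (I Ih : Ideal (MvPolynomial (Fin n) K)) (hI : I = Ideal.span (Set.range f))
    (hIh : Ih = Ideal.span (Set.range fun i => topComponent (f i))) :
    initialIdeal I = initialIdeal Ih ∧
      (Infinite K →
        (∃! J, IsGenericInitialIdeal Ih J) ∧
        ∃ U : Set (GL (Fin n) K), IsZariskiOpen U ∧ U.Nonempty ∧
          ∀ g ∈ U, minimalInitialGenerators (transformedIdeal g I) =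
            minimalInitialGenerators (genericInitialIdeal Ih)) := by
  subst hI hIh
  refine ⟨hf.topRegular.initialIdeal_eq, fun _ => ?_⟩
  have hex : ∃! J, IsGenericInitialIdeal (Ideal.span (Set.range fun i => topComponent (f i))) J :=
    ContainsComponents.existsUnique_isGenericInitialIdeal fun p hp d =>
      homogeneousComponent_mem_span_range (fun i => topComponent_isHomogeneous (f i)) hp d
  refine ⟨hex, ?_⟩
  have hgin : IsGenericInitialIdeal (Ideal.span (Set.range fun i => topComponent (f i)))
      (genericInitialIdeal (Ideal.span (Set.range fun i => topComponent (f i)))) := by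
    rw [genericInitialIdeal, dif_pos hex.exists]
    exact hex.exists.choose_spec
  obtain ⟨hmon, U, hU, hne, h⟩ := hgin
  refine ⟨U, hU, hne, fun g hg => ?_⟩
  -- The first statement for the transformed sequence, which is again regular, replaces `g · I` by
  -- `g · Iʰ`; so the open set defining `Gin(Iʰ)` already serves.
  have e : initialIdeal (transformedIdeal g (Ideal.span (Set.range f))) =
      initialIdeal (genericInitialIdeal (Ideal.span (Set.range fun i => topComponent (f i)))) := by
    rw [hmon.initialIdeal_eq, ← h g hg, transformedIdeal_span, transformedIdeal_span,
      (hf.topRegular.linearSubst g).initialIdeal_eq]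
    simp_rw [topComponent_linearSubst]
  rw [minimalInitialGenerators, minimalInitialGenerators, e]
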